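/- Let $\mathcal V$ be a countably infinite set of quantum variables, each of them a qubit. For finite $V\subseteq\mathcal V$ let $\mathcal H_V=\bigotimes_{q\in V}\mathbb C^2$, let $\mathcal D(\mathcal H_V)$ be the set of positive operators on $\mathcal H_V$ with trace at most $1$, and let $\mathcal P(\mathcal H_V)$ be the set of effects, i.e. operators $M$ with $0\sqsubseteq M\sqsubseteq I$ in the Löwner order. Let $\mathit{DProg}(V)$ be the set of completely positive, trace-nonincreasing linear maps on the operators of $\mathcal H_V$, and $\mathit{NProg}(V)$ the set of nonempty, convex, closed subsets of $\mathit{DProg}(V)$. Operators and super-operators on a subsystem are extended to a larger finite system by tensoring with the identity. For $\rho\in\mathcal D(\mathcal H_X)$ and $\Theta\subseteq\mathcal P(\mathcal H_W)$ with $W\subseteq X$ put $\mathrm{Exp}_{\mathsf{dem}}(\rho\models\Theta)=\inf_{M\in\Theta}\mathrm{tr}(M\rho)$, with the convention that this is $\mathrm{tr}(\rho)$ if $\Theta=\emptyset$. For $\mathcal E\in\mathit{DProg}(V)$ and $M,N\in\mathcal P(\mathcal H_W)$, write $\mathcal E\models_{\mathsf{tot}}(M,N)$ if $\mathrm{tr}(M\rho)\le\mathrm{tr}(N\mathcal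 E(\rho))$, and $\mathcal E\models_{\mathsf{par}}(M,N)$ if $\mathrm{tr}(M\rho)\le\mathrm{tr}(N\mathcal E(\rho))+\mathrm{tr}(\rho)-\mathrm{tr}(\mathcal E(\rho))$, in each case for all finite $X$ with $V\cup W\subseteq X\subseteq\mathcal V$ and all $\rho\in\mathcal D(\mathcal H_X)$. For $S\in\mathit{NProg}(V)$, $\Theta,\Psi\subseteq\mathcal P(\mathcal H_W)$ and $S(\rho)=\{\mathcal E(\rho):\mathcal E\in S\}$, write $S\models_{\mathsf{tot}}(\Theta,\Psi)$ if $\mathrm{Exp}_{\mathsf{dem}}(\rho\models\Theta)\le\inf_{\sigma\in S(\rho)}\mathrm{Exp}_{\mathsf{dem}}(\sigma\models\Psi)$, and $S\models_{\mathsf{par}}(\Theta,\Psi)$ if $\mathrm{Exp}_{\mathsf{dem}}(\rho\models\Theta)\le\inf_{\sigma\in S(\rho)}\bigl(\mathrm{Exp}_{\mathsf{dem}}(\sigma\models\Psi)+\mathrm{tr}(\rho)-\mathrm{tr}(\sigma)\bigr)$, for the same $X$ and $\rho$. For $\mathcal E,\mathcal F\in\mathit{DProg}(V)$, write $\mathcal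 E\le_T^e\mathcal F$ (resp. $\mathcal E\le_P^e\mathcal F$) if for every finite $W\subseteq\mathcal V$ and all $M,N\in\mathcal P(\mathcal H_W)$, $\mathcal E\models_{\mathsf{tot}}(M,N)$ implies $\mathcal F\models_{\mathsf{tot}}(M,N)$ (resp. the same with $\models_{\mathsf{par}}$). For $S,T\in\mathit{NProg}(V)$, write $S\le_T^s T$ (resp. $S\le_P^s T$) if for every finite $W\subseteq\mathcal V$ and all $\Theta,\Psi\subseteq\mathcal P(\mathcal H_W)$, $S\models_{\mathsf{tot}}(\Theta,\Psi)$ implies $T\models_{\mathsf{tot}}(\Theta,\Psi)$ (resp. the same with $\models_{\mathsf{par}}$). **Corollary.** For every finite $V\subseteq\mathcal V$ and all $\mathcal E,\mathcal F\in\mathit{DProg}(V)$: 1. $\{\mathcal E\}\le_T^s\{\mathcal F\}$ if and only if $\mathcal E\le_T^e\mathcal F$; 2. $\{\mathcal E\}\le_P^s\{\mathcal F\}$ if and only if $\mathcal E\le_P^e\mathcal F$. -/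

import Mathlib

open scoped Kronecker ComplexOrder

namespace QRefine

noncomputable section

/-! ### Super-operators on matrix algebras -/

/-- The map `𝓘 ⊗ E` on block matrices, `𝓘` the identity super-operator on `Matrix k k ℂ`:
an operator on `ℂᵏ ⊗ ℂᵐ` is regarded as a `k × k` matrix of blocks in `Matrix m m ℂ`, and `E` is
applied to every block. It is the linear map that sends `A ⊗ₖ B` to `A ⊗ₖ E B`. -/
def ampliation (k : Type*) {m n : Type*} (E : Matrix m m ℂ →ₗ[ℂ] Matrix n n ℂ)
    (ρ : Matrix (k × m) (k × m) ℂ) : Matrix (k × n) (k × n) ℂ :=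
  Matrix.comp k k n n ℂ (((Matrix.comp k k m m ℂ).symm ρ).map E)

/-- Complete positivity: `𝓘 ⊗ E` is positive for every finite-dimensional ancilla. -/
def IsCompletelyPositive {m n : Type*} [Fintype m] [Fintype n]
    (E : Matrix m m ℂ →ₗ[ℂ] Matrix n n ℂ) : Prop :=
  ∀ (k : ℕ) (ρ : Matrix (Fin k × m) (Fin k × m) ℂ),
    ρ.PosSemidef → (ampliation (Fin k) E ρ).PosSemidef

/-- Traces of positive operators are real, so they are compared through their real parts. -/
def IsTraceNonincreasing {m n : Type*} [Fintype m] [Fintype n]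
    (E : Matrix m m ℂ →ₗ[ℂ] Matrix n n ℂ) : Prop :=
  ∀ A : Matrix m m ℂ, A.PosSemidef → (E A).trace.re ≤ A.trace.re

/-! ### Quantum variables, operators, states and effects -/

variable {Q : Type*} [DecidableEq Q]

/-- Index set of the computational basis of `⨂_{q ∈ V} ℂ²`. -/
abbrev Idx (V : Finset Q) : Type _ := V → Fin 2

/-- Linear operators on the Hilbert space of the qubits in `V`, in the computational basis. -/
abbrev Op (V : Finset Q) : Type _ := Matrix (Idx V) (Idx V) ℂ

/-- Partial density operators: positive with trace at most `1`. -/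
def IsPartialDensity {X : Finset Q} (ρ : Op X) : Prop :=
  ρ.PosSemidef ∧ ρ.trace.re ≤ 1

/-- Effects: operators between `0` and the identity in the Löwner order. -/
def Effect (W : Finset Q) : Type _ :=
  {M : Op W // M.PosSemidef ∧ (1 - M).PosSemidef}

/-- The splitting `H_X = H_{X \ V} ⊗ H_V` on basis indices, for `V ⊆ X`. -/
def splitIdx {V X : Finset Q} (h : V ⊆ X) : Idx X ≃ Idx (X \ V) × Idx V where
  toFun x := (fun q => x ⟨q.1, (Finset.mem_sdiff.1 q.2).1⟩, fun q => x ⟨q.1, h q.2⟩)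
  invFun p q :=
    if hq : q.1 ∈ V then p.2 ⟨q.1, hq⟩ else p.1 ⟨q.1, Finset.mem_sdiff.2 ⟨q.2, hq⟩⟩
  left_inv x := by
    funext q
    by_cases hq : q.1 ∈ V <;> simp [hq]
  right_inv p := by
    refine Prod.ext ?_ ?_
    · funext q
      simp [(Finset.mem_sdiff.1 q.2).2]
    · funext q
      simp

/-- `I_{X \ W} ⊗ M` as an operator on `H_X`. -/
def extOp {W X : Finset Q} (h : W ⊆ X) (M : Op W) : Op X :=
  Matrix.reindex (splitIdx h).symm (splitIdx h).symm ((1 : Op (X \ W)) ⊗ₖ M)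

/-- `(𝓘_{X \ V} ⊗ E)(ρ)` for an operator `ρ` on `H_X`. -/
def extSuper {V X : Finset Q} (h : V ⊆ X) (E : Op V →ₗ[ℂ] Op V) (ρ : Op X) : Op X :=
  Matrix.reindex (splitIdx h).symm (splitIdx h).symm
    (ampliation (Idx (X \ V)) E (Matrix.reindex (splitIdx h) (splitIdx h) ρ))

/-! ### Programs -/

/-- Deterministic programs: completely positive trace-nonincreasing super-operators. -/
def DProg (V : Finset Q) : Type _ :=
  {E : Op V →ₗ[ℂ] Op V // IsCompletelyPositive E ∧ IsTraceNonincreasing E}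

/-- The output of a deterministic program on a state of a larger system. -/
def DProg.run {V X : Finset Q} (E : DProg V) (h : V ⊆ X) (ρ : Op X) : Op X :=
  extSuper h E.1 ρ

/-- Nondeterministic programs: nonempty, convex, closed sets of deterministic programs. On linear
maps between finite-dimensional spaces the Euclidean topology is that of pointwise convergence. -/
structure NProg (V : Finset Q) where
  carrier : Set (DProg V)
  nonempty : carrier.Nonempty
  convex : Convex ℝ ((fun E : DProg V => E.1) '' carrier)
  closed : IsClosed ((fun (E : DProg V) (A : Op V) => E.1 A) '' carrier)

/-- A deterministic program as a singleton nondeterministic program. -/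
def DProg.toNProg {V : Finset Q} (E : DProg V) : NProg V where
  carrier := {E}
  nonempty := Set.singleton_nonempty E
  convex := by
    rw [Set.image_singleton]
    exact convex_singleton _
  closed := by
    rw [Set.image_singleton]
    exact isClosed_singleton

/-- The set of outputs `{E(ρ) : E ∈ S}` of a nondeterministic program. -/
def NProg.run {V X : Finset Q} (S : NProg V) (h : V ⊆ X) (ρ : Op X) : Set (Op X) :=
  {σ | ∃ E ∈ S.carrier, σ = E.run h ρ}

/-! ### Expectations -/

/-- The degree `tr(Mρ)` to which `ρ` satisfies `M`, with `M` extended to the system of `ρ`. -/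
def expect {W X : Finset Q} (h : W ⊆ X) (ρ : Op X) (M : Effect W) : ℝ :=
  (extOp h M.1 * ρ).trace.re

open Classical in
/-- Demonic satisfaction `inf_{M ∈ Θ} tr(Mρ)`, which is `tr(ρ)` by convention if `Θ` is empty. -/
def expDem {W X : Finset Q} (h : W ⊆ X) (ρ : Op X) (Θ : Set (Effect W)) : ℝ :=
  if Θ = ∅ then ρ.trace.re else sInf (expect h ρ '' Θ)

/-! ### Satisfaction of specifications

The state `ρ` ranges over the partial density operators of every finite system `X ⊇ V ∪ W`. -/

/-- `E ⊨_tot (M, N)`. -/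
def DProg.SatTot {V W : Finset Q} (E : DProg V) (M N : Effect W) : Prop :=
  ∀ (X : Finset Q) (hV : V ⊆ X) (hW : W ⊆ X) (ρ : Op X), IsPartialDensity ρ →
    expect hW ρ M ≤ expect hW (E.run hV ρ) N

/-- `E ⊨_par (M, N)`. -/
def DProg.SatPar {V W : Finset Q} (E : DProg V) (M N : Effect W) : Prop :=
  ∀ (X : Finset Q) (hV : V ⊆ X) (hW : W ⊆ X) (ρ : Op X), IsPartialDensity ρ →
    expect hW ρ M ≤ expect hW (E.run hV ρ) N + ρ.trace.re - (E.run hV ρ).trace.re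

/-- `S ⊨_tot (Θ, Ψ)`. -/
def NProg.SatTot {V W : Finset Q} (S : NProg V) (Θ Ψ : Set (Effect W)) : Prop :=
  ∀ (X : Finset Q) (hV : V ⊆ X) (hW : W ⊆ X) (ρ : Op X), IsPartialDensity ρ →
    expDem hW ρ Θ ≤ sInf ((fun σ => expDem hW σ Ψ) '' S.run hV ρ)

/-- `S ⊨_par (Θ, Ψ)`. -/
def NProg.SatPar {V W : Finset Q} (S : NProg V) (Θ Ψ : Set (Effect W)) : Prop :=
  ∀ (X : Finset Q) (hV : V ⊆ X) (hW : W ⊆ X) (ρ : Op X), IsPartialDensity ρ →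
    expDem hW ρ Θ ≤
      sInf ((fun σ => expDem hW σ Ψ + ρ.trace.re - σ.trace.re) '' S.run hV ρ)

/-! ### Refinement orders: every satisfied specification, on any finite system `W`, is preserved -/

/-- Effect-based refinement in total correctness. -/
def DProg.RefTotEffect {V : Finset Q} (E F : DProg V) : Prop :=
  ∀ (W : Finset Q) (M N : Effect W), E.SatTot M N → F.SatTot M N

/-- Effect-based refinement in partial correctness. -/
def DProg.RefParEffect {V : Finset Q} (E F : DProg V) : Prop :=
  ∀ (W : Finset Q) (M N : Effect W), E.SatPar M N → F.SatPar M N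

/-- Set-of-effects refinement in total correctness. -/
def NProg.RefTotSet {V : Finset Q} (S T : NProg V) : Prop :=
  ∀ (W : Finset Q) (Θ Ψ : Set (Effect W)), S.SatTot Θ Ψ → T.SatTot Θ Ψ

/-- Set-of-effects refinement in partial correctness. -/
def NProg.RefParSet {V : Finset Q} (S T : NProg V) : Prop :=
  ∀ (W : Finset Q) (Θ Ψ : Set (Effect W)), S.SatPar Θ Ψ → T.SatPar Θ Ψ

end

end QRefine

namespace QRefine

open scoped Kronecker ComplexOrder

/-! ### Positive matrices and the trace pairing -/

/-! Both effect-based orders are pointwise orders on outputs. The weakest precondition `M` of `N`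
under `E` satisfies `tr(Mρ) = tr(N E(ρ))`, so `E` meets `(M, N)` with equality, and refinement gives
`tr(N E(ρ)) ≤ tr(N F(ρ))`. In partial correctness `E` meets `(I - M, I - N)` with equality, and the
inequality is reversed (`RefTotEffect.expect_le`, `RefParEffect.expect_le`). Such bounds, uniform in
`N`, pass to infima over sets of effects (`expDem_le_expDem_add`), hence to set specifications; the
converse uses singleton sets.

States live on arbitrarily large systems. The partial trace, dual to `M ↦ I ⊗ M` and commuting with
programs, brings everything back to a fixed system. -/

lemma trace_mul_vecMulVec_star {n : Type*} [Fintype n] (M : Matrix n n ℂ) (v : n → ℂ) :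
    (M * Matrix.vecMulVec v (star v)).trace = star v ⬝ᵥ M.mulVec v := by
  rw [Matrix.mul_vecMulVec, Matrix.trace_vecMulVec, dotProduct_comm]

lemma trace_mul_nonneg {n : Type*} [Fintype n] [DecidableEq n] {M ρ : Matrix n n ℂ}
    (hM : M.PosSemidef) (hρ : ρ.PosSemidef) : 0 ≤ (M * ρ).trace := by
  obtain ⟨m, v, rfl⟩ := Matrix.posSemidef_iff_eq_sum_vecMulVec.1 hρ
  rw [Finset.mul_sum, Matrix.trace_sum]
  refine Finset.sum_nonneg fun i _ => ?_
  rw [trace_mul_vecMulVec_star]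
  exact hM.dotProduct_mulVec_nonneg _

/-- Rank-one `ρ` suffice. Nonnegativity in the order of `ℂ` makes the quadratic form real, so `M`
need not be assumed Hermitian. -/
lemma posSemidef_of_trace_mul_nonneg {n : Type*} [Fintype n] [DecidableEq n] {M : Matrix n n ℂ}
    (h : ∀ ρ : Matrix n n ℂ, ρ.PosSemidef → 0 ≤ (M * ρ).trace) : M.PosSemidef := by
  rw [← Matrix.isPositive_toEuclideanLin_iff, LinearMap.isPositive_iff_complex]
  intro x
  have hx := h _ (Matrix.posSemidef_vecMulVec_self_star x.ofLp)
  rw [trace_mul_vecMulVec_star] at hx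
  have hin : inner ℂ (M.toEuclideanLin x) x = star (star x.ofLp ⬝ᵥ M.mulVec x.ofLp) := by
    rw [EuclideanSpace.inner_eq_star_dotProduct, ← Matrix.star_dotProduct,
      dotProduct_comm]
    rfl
  have hs : star (star x.ofLp ⬝ᵥ M.mulVec x.ofLp) = star x.ofLp ⬝ᵥ M.mulVec x.ofLp :=
    (IsSelfAdjoint.of_nonneg hx).star_eq
  rw [hin, hs]
  rw [Complex.nonneg_iff] at hx
  refine ⟨Complex.ext ?_ ?_, hx.1⟩
  · simp
  · simpa using hx.2

/-- Every linear functional on matrices is a trace pairing. -/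
lemma exists_trace_mul_eq {n : Type*} [Fintype n] [DecidableEq n] (f : Matrix n n ℂ →ₗ[ℂ] ℂ) :
    ∃ M : Matrix n n ℂ, ∀ ρ, (M * ρ).trace = f ρ := by
  -- The indices are swapped because `tr(Mρ) = ∑ M i j * ρ j i`.
  refine ⟨Matrix.of fun i j => f (Matrix.single j i 1), fun ρ => ?_⟩
  conv_rhs => rw [Matrix.matrix_eq_sum_single ρ]
  simp only [map_sum, Matrix.trace, Matrix.diag_apply, Matrix.mul_apply, Matrix.of_apply]
  rw [Finset.sum_comm]
  refine Finset.sum_congr rfl fun i _ => Finset.sum_congr rfl fun j _ => ?_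
  have hs : Matrix.single i j (ρ i j) = ρ i j • Matrix.single i j (1 : ℂ) := by
    rw [Matrix.smul_single, smul_eq_mul, mul_one]
  rw [hs, map_smul, smul_eq_mul, mul_comm]

variable {Q : Type*} [DecidableEq Q]

/-! ### Partial trace -/

/-- The partial trace over the qubits of `X` outside `W`. -/
def partialTrace {W X : Finset Q} (h : W ⊆ X) (ρ : Op X) : Op W :=
  ∑ z : Idx (X \ W), ρ.submatrix (fun x => (splitIdx h).symm (z, x))
    (fun x => (splitIdx h).symm (z, x))

lemma partialTrace_apply {W X : Finset Q} (h : W ⊆ X) (ρ : Op X) (x y : Idx W) :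
    partialTrace h ρ x y =
      ∑ z : Idx (X \ W), ρ ((splitIdx h).symm (z, x)) ((splitIdx h).symm (z, y)) := by
  simp [partialTrace, Matrix.sum_apply]

lemma posSemidef_partialTrace {W X : Finset Q} (h : W ⊆ X) {ρ : Op X} (hρ : ρ.PosSemidef) :
    (partialTrace h ρ).PosSemidef :=
  Matrix.posSemidef_sum _ fun _ _ => hρ.submatrix _

lemma trace_extOp_mul {W X : Finset Q} (h : W ⊆ X) (M : Op W) (ρ : Op X) :
    (extOp h M * ρ).trace = (M * partialTrace h ρ).trace := by
  have hl : (extOp h M * ρ).trace = ∑ x : Idx X, ∑ y : Idx X, extOp h M x y * ρ y x := rfl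
  have hr : (M * partialTrace h ρ).trace
      = ∑ x : Idx W, ∑ y : Idx W, M x y * partialTrace h ρ y x := rfl
  rw [hl, hr, ← (splitIdx h).symm.sum_comp]
  simp_rw [← (splitIdx h).symm.sum_comp (fun y => _ * ρ y _)]
  simp only [Fintype.sum_prod_type, extOp, Matrix.reindex_apply, Matrix.submatrix_apply,
    Equiv.symm_symm, Equiv.apply_symm_apply, Matrix.kroneckerMap_apply, Matrix.one_apply,
    ite_mul, one_mul, zero_mul, partialTrace_apply, Finset.mul_sum]
  rw [Finset.sum_comm]
  refine Finset.sum_congr rfl fun x _ => ?_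
  rw [Finset.sum_comm]
  conv_lhs =>
    enter [2, x]
    rw [Finset.sum_comm]
  rw [Finset.sum_comm]
  simp

lemma trace_partialTrace {W X : Finset Q} (h : W ⊆ X) (ρ : Op X) :
    (partialTrace h ρ).trace = ρ.trace := by
  have hr : ρ.trace = ∑ x : Idx X, ρ x x := rfl
  have hl : (partialTrace h ρ).trace = ∑ x : Idx W, partialTrace h ρ x x := rfl
  rw [hl, hr, ← (splitIdx h).symm.sum_comp, Fintype.sum_prod_type, Finset.sum_comm]
  simp only [partialTrace_apply]

lemma splitIdx_symm_self {X : Finset Q} (h : X ⊆ X) (z : Idx (X \ X)) (x : Idx X) :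
    (splitIdx h).symm (z, x) = x := by
  funext q
  simp [splitIdx]

lemma partialTrace_self {X : Finset Q} (h : X ⊆ X) (ρ : Op X) : partialTrace h ρ = ρ := by
  ext x y
  -- No qubit is discarded, so the sum over `z` has a single term.
  have : IsEmpty {q // q ∈ X \ X} := ⟨fun q => by simpa using q.2⟩
  simp [partialTrace_apply, splitIdx_symm_self]

/-! ### Super-operators on a larger system -/

lemma extSuper_apply {V X : Finset Q} (h : V ⊆ X) (E : Op V →ₗ[ℂ] Op V) (ρ : Op X)
    (x y : Idx X) :
    extSuper h E ρ x y =
      E (ρ.submatrix (fun v => (splitIdx h).symm ((splitIdx h x).1, v))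
        (fun v => (splitIdx h).symm ((splitIdx h y).1, v))) (splitIdx h x).2 (splitIdx h y).2 :=
  rfl

/-- `extSuper` as a linear map. -/
def extSuperLin {V X : Finset Q} (h : V ⊆ X) (E : Op V →ₗ[ℂ] Op V) : Op X →ₗ[ℂ] Op X where
  toFun := extSuper h E
  map_add' ρ σ := by
    ext x y
    simp [extSuper_apply, Matrix.submatrix_add]
  map_smul' c ρ := by
    ext x y
    simp [extSuper_apply, Matrix.submatrix_smul]

/-- Discarding qubits on which a super-operator does not act commutes with it. -/
lemma partialTrace_extSuper {V X Y : Finset Q} (hV : V ⊆ X) (hX : X ⊆ Y) (hVY : V ⊆ Y)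
    (E : Op V →ₗ[ℂ] Op V) (ρ : Op Y) :
    partialTrace hX (extSuper hVY E ρ) = extSuper hV E (partialTrace hX ρ) := by
  ext x y
  have hsnd : ∀ (z : Idx (Y \ X)) (w : Idx X),
      (splitIdx hVY ((splitIdx hX).symm (z, w))).2 = (splitIdx hV w).2 := by
    intro z w
    funext q
    simp [splitIdx, hV q.2]
  have hfst : ∀ (z : Idx (Y \ X)) (w : Idx X) (v : Idx V),
      (splitIdx hVY).symm ((splitIdx hVY ((splitIdx hX).symm (z, w))).1, v)
        = (splitIdx hX).symm (z, (splitIdx hV).symm ((splitIdx hV w).1, v)) := by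
    intro z w v
    funext q
    by_cases hq : q.1 ∈ V
    · simp [splitIdx, hq, hV hq]
    · by_cases hq' : q.1 ∈ X <;> simp [splitIdx, hq, hq']
  simp only [partialTrace_apply, extSuper_apply, hsnd, hfst]
  rw [← Matrix.sum_apply, ← map_sum]
  refine congrArg (fun A : Op V => E A (splitIdx hV x).2 (splitIdx hV y).2) ?_
  ext v w
  simp [Matrix.sum_apply, partialTrace_apply]

namespace DProg

variable {V X : Finset Q}

lemma posSemidef_run (E : DProg V) (h : V ⊆ X) {ρ : Op X} (hρ : ρ.PosSemidef) :
    (E.run h ρ).PosSemidef := by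
  -- Complete positivity speaks of ancillas `Fin k`, so the basis of the remaining qubits is
  -- renumbered.
  obtain ⟨e⟩ := Fintype.truncEquivFin (Idx (X \ V))
  have hk := E.2.1 _ _ (hρ.submatrix fun p : Fin _ × Idx V => (splitIdx h).symm (e.symm p.1, p.2))
  have := hk.submatrix fun x : Idx X => (e (splitIdx h x).1, (splitIdx h x).2)
  convert this using 1
  ext x y
  change extSuper h E.1 ρ x y = E.1 (Matrix.of fun v w => ρ
    ((splitIdx h).symm (e.symm (e (splitIdx h x).1), v))
    ((splitIdx h).symm (e.symm (e (splitIdx h y).1), w))) _ _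
  simp only [Equiv.symm_apply_apply]
  rfl

lemma extSuper_self (h : V ⊆ V) (E : Op V →ₗ[ℂ] Op V) (ρ : Op V) : extSuper h E ρ = E ρ := by
  ext x y
  simp only [extSuper_apply, splitIdx_symm_self]
  rfl

/-- Tracing out the qubits outside `V` preserves traces and commutes with the program, which leaves
the hypothesis on `E` itself. -/
lemma trace_run_le (E : DProg V) (h : V ⊆ X) {ρ : Op X} (hρ : ρ.PosSemidef) :
    (E.run h ρ).trace.re ≤ ρ.trace.re := by
  rw [run, ← trace_partialTrace h (extSuper h E.1 ρ),
    partialTrace_extSuper (Finset.Subset.refl V) h h, extSuper_self, ← trace_partialTrace h ρ]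
  exact E.2.2 _ (posSemidef_partialTrace h hρ)

end DProg

/-! ### Expectations -/

lemma expect_eq {W X : Finset Q} (h : W ⊆ X) (ρ : Op X) (M : Effect W) :
    expect h ρ M = (M.1 * partialTrace h ρ).trace.re := by
  rw [expect, trace_extOp_mul]

lemma expect_nonneg {W X : Finset Q} (h : W ⊆ X) {ρ : Op X} (hρ : ρ.PosSemidef)
    (M : Effect W) : 0 ≤ expect h ρ M := by
  rw [expect_eq]
  exact (Complex.nonneg_iff.1 (trace_mul_nonneg M.2.1 (posSemidef_partialTrace h hρ))).1

lemma bddBelow_expect {W X : Finset Q} (h : W ⊆ X) {ρ : Op X} (hρ : ρ.PosSemidef)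
    (Ψ : Set (Effect W)) : BddBelow (expect h ρ '' Ψ) :=
  ⟨0, by rintro _ ⟨M, -, rfl⟩; exact expect_nonneg h hρ M⟩

/-- The effect `I - M`. -/
def Effect.compl {W : Finset Q} (M : Effect W) : Effect W :=
  ⟨1 - M.1, M.2.2, by simpa using M.2.1⟩

lemma expect_compl {W X : Finset Q} (h : W ⊆ X) (ρ : Op X) (M : Effect W) :
    expect h ρ M.compl = ρ.trace.re - expect h ρ M := by
  have h1 : expect h ρ M.compl = ((1 - M.1) * partialTrace h ρ).trace.re := expect_eq h ρ _
  rw [h1, expect_eq, sub_mul, one_mul, Matrix.trace_sub, Complex.sub_re, trace_partialTrace]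

/-- By duality, effects correspond to the functionals lying between `0` and the trace on positive
operators. -/
lemma exists_effect {W : Finset Q} {M : Op W}
    (h0 : ∀ ρ : Op W, ρ.PosSemidef → 0 ≤ (M * ρ).trace)
    (h1 : ∀ ρ : Op W, ρ.PosSemidef → (M * ρ).trace ≤ ρ.trace) :
    ∃ N : Effect W, ∀ (X : Finset Q) (h : W ⊆ X) (ρ : Op X),
      expect h ρ N = (M * partialTrace h ρ).trace.re := by
  refine ⟨⟨M, posSemidef_of_trace_mul_nonneg h0, posSemidef_of_trace_mul_nonneg fun ρ hρ => ?_⟩,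
    fun X h ρ => expect_eq h ρ _⟩
  rw [sub_mul, Matrix.trace_sub, one_mul]
  exact sub_nonneg.2 (h1 ρ hρ)

lemma Effect.trace_mul_le {W : Finset Q} (N : Effect W) {ρ : Op W} (hρ : ρ.PosSemidef) :
    (N.1 * ρ).trace ≤ ρ.trace := by
  have := trace_mul_nonneg N.2.2 hρ
  rwa [sub_mul, Matrix.trace_sub, one_mul, sub_nonneg] at this

/-- The extension of an effect to a larger system is an effect with the same expectations. -/
lemma exists_effect_extOp {W X : Finset Q} (h : W ⊆ X) (N : Effect W) :
    ∃ N' : Effect X, ∀ (hX : X ⊆ X) (ρ : Op X), expect hX ρ N' = expect h ρ N := by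
  obtain ⟨N', hN'⟩ := exists_effect (M := extOp h N.1)
    (fun ρ hρ => by
      rw [trace_extOp_mul]
      exact trace_mul_nonneg N.2.1 (posSemidef_partialTrace h hρ))
    (fun ρ hρ => by
      rw [trace_extOp_mul, ← trace_partialTrace h ρ]
      exact N.trace_mul_le (posSemidef_partialTrace h hρ))
  refine ⟨N', fun hX ρ => ?_⟩
  rw [hN', partialTrace_self]
  rfl

/-- The weakest precondition of an effect on a system containing that of the program. -/
lemma DProg.exists_wp {V X : Finset Q} (E : DProg V) (hV : V ⊆ X) (N : Effect X) :
    ∃ M : Effect X, ∀ (Y : Finset Q) (hVY : V ⊆ Y) (hX : X ⊆ Y) (ρ : Op Y),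
      expect hX ρ M = expect hX (E.run hVY ρ) N := by
  obtain ⟨M, hM⟩ := exists_trace_mul_eq
    (Matrix.traceLinearMap (Idx X) ℂ ℂ ∘ₗ LinearMap.mulLeft ℂ N.1 ∘ₗ extSuperLin hV E.1)
  replace hM : ∀ ρ, (M * ρ).trace = (N.1 * E.run hV ρ).trace := hM
  obtain ⟨M', hM'⟩ := exists_effect (M := M)
    (fun ρ hρ => by
      rw [hM]
      exact trace_mul_nonneg N.2.1 (E.posSemidef_run hV hρ))
    (fun ρ hρ => by
      have hE := E.posSemidef_run hV hρ
      rw [hM]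
      -- The order on `ℂ` also requires equal imaginary parts; both vanish.
      refine (N.trace_mul_le hE).trans (Complex.le_def.2 ⟨E.trace_run_le hV hρ, ?_⟩)
      rw [← (Complex.nonneg_iff.1 hE.trace_nonneg).2, ← (Complex.nonneg_iff.1 hρ.trace_nonneg).2])
  refine ⟨M', fun Y hVY hX ρ => ?_⟩
  rw [hM', expect_eq, hM, DProg.run, DProg.run, partialTrace_extSuper hV hX hVY]

/-! ### The refinement orders on states -/

namespace DProg

variable {V : Finset Q} {E F : DProg V}

lemma RefTotEffect.expect_le (hEF : E.RefTotEffect F) {W X : Finset Q} (hV : V ⊆ X) (hW : W ⊆ X)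
    {ρ : Op X} (hρ : IsPartialDensity ρ) (N : Effect W) :
    expect hW (E.run hV ρ) N ≤ expect hW (F.run hV ρ) N := by
  obtain ⟨N', hN'⟩ := exists_effect_extOp hW N
  obtain ⟨M, hM⟩ := E.exists_wp hV N'
  -- `N` is first moved to `X`, since `W` need not contain `V`.
  have := hEF X M N' (fun Y hVY hX σ _ => (hM Y hVY hX σ).le) X hV (Finset.Subset.refl X) ρ hρ
  rwa [hM X hV, hN', hN'] at this

lemma RefParEffect.expect_le (hEF : E.RefParEffect F) {W X : Finset Q} (hV : V ⊆ X) (hW : W ⊆ X)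
    {ρ : Op X} (hρ : IsPartialDensity ρ) (N : Effect W) :
    expect hW (F.run hV ρ) N ≤ expect hW (E.run hV ρ) N := by
  obtain ⟨N', hN'⟩ := exists_effect_extOp hW N
  obtain ⟨M, hM⟩ := E.exists_wp hV N'
  have := hEF X M.compl N'.compl (fun Y hVY hX σ _ => by
    rw [expect_compl, expect_compl, hM Y hVY]; linarith) X hV (Finset.Subset.refl X) ρ hρ
  rw [expect_compl, expect_compl, hM X hV, hN', hN'] at this
  linarith

/-- The identity operator, as an effect. -/
lemma exists_effect_one (W : Finset Q) :
    ∃ N : Effect W, ∀ (X : Finset Q) (h : W ⊆ X) (ρ : Op X), expect h ρ N = ρ.trace.re := by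
  obtain ⟨N, hN⟩ := exists_effect (M := (1 : Op W))
    (fun ρ hρ => by simpa using hρ.trace_nonneg) (fun ρ _ => by simp)
  exact ⟨N, fun X h ρ => by rw [hN, one_mul, trace_partialTrace]⟩

lemma satTot_toNProg_iff {W : Finset Q} (Θ Ψ : Set (Effect W)) :
    E.toNProg.SatTot Θ Ψ ↔ ∀ (X : Finset Q) (hV : V ⊆ X) (hW : W ⊆ X) (ρ : Op X),
      IsPartialDensity ρ → expDem hW ρ Θ ≤ expDem hW (E.run hV ρ) Ψ := by
  simp [NProg.SatTot, NProg.run, toNProg]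

lemma satPar_toNProg_iff {W : Finset Q} (Θ Ψ : Set (Effect W)) :
    E.toNProg.SatPar Θ Ψ ↔ ∀ (X : Finset Q) (hV : V ⊆ X) (hW : W ⊆ X) (ρ : Op X),
      IsPartialDensity ρ →
        expDem hW ρ Θ ≤ expDem hW (E.run hV ρ) Ψ + ρ.trace.re - (E.run hV ρ).trace.re := by
  simp [NProg.SatPar, NProg.run, toNProg]

end DProg

lemma expDem_singleton {W X : Finset Q} (h : W ⊆ X) (ρ : Op X) (M : Effect W) :
    expDem h ρ {M} = expect h ρ M := by
  simp [expDem]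

/-- If all expectations on `ρ` exceed those on `σ` by at most `c`, so does the demonic one. -/
lemma expDem_le_expDem_add {W X : Finset Q} (h : W ⊆ X) {ρ σ : Op X} (hρ : ρ.PosSemidef) {c : ℝ}
    (htr : ρ.trace.re ≤ σ.trace.re + c) (hle : ∀ N, expect h ρ N ≤ expect h σ N + c)
    (Ψ : Set (Effect W)) : expDem h ρ Ψ ≤ expDem h σ Ψ + c := by
  unfold expDem
  split_ifs with hΨ
  -- For empty `Ψ` both demonic expectations are traces by convention.
  · exact htr
  · rw [← sub_le_iff_le_add]
    refine le_csInf ((Set.nonempty_iff_ne_empty.2 hΨ).image _) ?_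
    rintro _ ⟨N, hN, rfl⟩
    rw [sub_le_iff_le_add]
    exact (csInf_le (bddBelow_expect h hρ Ψ) ⟨N, hN, rfl⟩).trans (hle N)

namespace DProg

variable {V : Finset Q} {E F : DProg V}

lemma refTotSet_toNProg_iff : E.toNProg.RefTotSet F.toNProg ↔ E.RefTotEffect F := by
  constructor
  · intro h W M N hE
    have := h W {M} {N}
    simp only [satTot_toNProg_iff, expDem_singleton] at this
    exact this hE
  · intro h W Θ Ψ hE
    rw [satTot_toNProg_iff] at hE ⊢
    intro X hV hW ρ hρ
    have hle := expDem_le_expDem_add hW (ρ := E.run hV ρ) (σ := F.run hV ρ) (c := 0)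
      (E.posSemidef_run hV hρ.1) ?_ (fun N => by simpa using h.expect_le hV hW hρ N) Ψ
    · linarith [hE X hV hW ρ hρ]
    -- The trace is the expectation of the identity effect.
    · obtain ⟨N, hN⟩ := exists_effect_one W
      simpa [hN] using h.expect_le hV hW hρ N

lemma refParSet_toNProg_iff : E.toNProg.RefParSet F.toNProg ↔ E.RefParEffect F := by
  constructor
  · intro h W M N hE
    have := h W {M} {N}
    simp only [satPar_toNProg_iff, expDem_singleton] at this
    exact this hE
  · intro h W Θ Ψ hE
    rw [satPar_toNProg_iff] at hE ⊢
    intro X hV hW ρ hρ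
    have hle := expDem_le_expDem_add hW (ρ := E.run hV ρ) (σ := F.run hV ρ)
      -- This `c` is the difference of the two nontermination terms `tr(ρ) - tr(σ)`.
      (c := (E.run hV ρ).trace.re - (F.run hV ρ).trace.re)
      (E.posSemidef_run hV hρ.1) (by linarith) (fun N => ?_) Ψ
    · linarith [hE X hV hW ρ hρ]
    -- Complementing `N` turns the reversed inequality back, at the cost of exactly `c`.
    · have := h.expect_le hV hW hρ N.compl
      rw [expect_compl, expect_compl] at this
      linarith

end DProg

end QRefine

theorem mainTheorem8 {Q : Type*} [DecidableEq Q] [Countable Q] [Infinite Q]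
    (V : Finset Q) (E F : QRefine.DProg V) :
    (E.toNProg.RefTotSet F.toNProg ↔ E.RefTotEffect F) ∧
      (E.toNProg.RefParSet F.toNProg ↔ E.RefParEffect F) :=
  ⟨QRefine.DProg.refTotSet_toNProg_iff, QRefine.DProg.refParSet_toNProg_iff⟩
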